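/- For $p\in[0,1]$ let $\mathrm{SBern}(p,n)$ be the law of a random vector in $\{\pm1\}^n$ whose entries are independent, each equal to $+1$ with probability $p$ and to $-1$ with probability $1-p$. Let $\mathcal E_n$ be the elliptope, that is, the set of real positive semidefinite $n\times n$ matrices with all diagonal entries equal to $1$. A face of a convex set $K$ is a convex subset $F\subseteq K$ such that $x,y\in K$ and $\theta x+(1-\theta)y\in F$ for some $\theta\in(0,1)$ imply $x,y\in F$; its dimension is the dimension of its affine hull, and a $k$-dimensional face is simplicial if it is the convex hull of $k+1$ affinely independent points. Theorem 3 (Simplicial Faces III). There is an absolute constant $c\ge 0.0003$ with the following property. Let $p\in(0,1)$, let $r\ge 1$ and $n$ be natural numbers, let $\xi_1,\dots,\xi_r$ be independent random vectors with law $\mathrm{SBern}(p,n)$, and let $$F:=\operatorname{conv}\{\xi_1\xi_1^{t},\dots,\xi_r\xi_r^{t}\}\subset\mathcal E_n .$$ Then $$\mathbb P\{F\text{ is a simplicial face of }\mathcal E_n\text{ of dimension }r-1\}\ \ge\ 1-4\exp\left(\frac{r^2-c\,p^2(1-p)^2\,n}{4}\right).$$ -/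

import Mathlib

open MeasureTheory ProbabilityTheory

/-- The elliptope `𝓔ₙ`: real positive semidefinite `n × n` matrices (correlation matrices) all of
whose diagonal entries equal one. `Matrix.PosSemidef` includes symmetry. -/
def elliptope (n : ℕ) : Set (Matrix (Fin n) (Fin n) ℝ) :=
  {X | X.PosSemidef ∧ ∀ i, X i i = 1}

section Faces

variable {E : Type*} [AddCommGroup E] [Module ℝ E]

/-- The dimension of a (nonempty, finite-dimensional) convex set: the dimension of its
affine hull. -/
noncomputable def convexDim (K : Set E) : ℕ :=
  Module.finrank ℝ (affineSpan ℝ K).direction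

/-- `F` is a face of the convex set `K`: a convex extreme subset of `K`. -/
def IsFace (K F : Set E) : Prop :=
  Convex ℝ F ∧ IsExtreme ℝ K F

/-- `F` is a simplicial face of `K`: with `k` the dimension of `F`, it is a face of `K` that is the
convex hull of an affinely independent family of `k + 1` points. -/
def IsSimplicialFace (K F : Set E) : Prop :=
  IsFace K F ∧
    ∃ v : Fin (convexDim F + 1) → E, AffineIndependent ℝ v ∧ F = convexHull ℝ (Set.range v)

end Faces

/-- The signed Bernoulli law on `{±1} ⊂ ℝ`: the value `+1` with probability `p` and the value `-1`
with probability `1 - p`. -/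
noncomputable def sBern (p : unitInterval) : Measure ℝ :=
  bernoulliMeasure 1 (-1) p

/-- The law of a random vector with `n` independent signed Bernoulli entries. -/
noncomputable def sBernVec (p : unitInterval) (n : ℕ) : Measure (Fin n → ℝ) :=
  Measure.pi fun _ => sBern p

/-- The cut matrix `c cᵗ` of a vector `c`. -/
def cutMatrix {n : ℕ} (c : Fin n → ℝ) : Matrix (Fin n) (Fin n) ℝ :=
  Matrix.vecMulVec c c

/-- The convex hull of the cut matrices of the vectors `c₁, …, c_r`. -/
def cutHull {n r : ℕ} (c : Fin r → Fin n → ℝ) : Set (Matrix (Fin n) (Fin n) ℝ) :=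
  convexHull ℝ (Set.range fun i => cutMatrix (c i))

/-! Let `C` be the `r × n` matrix with rows `ξ i`. Everything rests on one condition on its columns,
seen as `n` points of `{±1}ʳ`: no nonzero `s + ∑_{a<b} S_ab x_a x_b` vanishes at all of them. Under
this condition `C` has full row rank. Any matrix `x` of the elliptope lying on an open segment
through the hull is `Cᵗ S C` with `S` positive semidefinite. Its unit diagonal says that the form
`S` equals `1` at every column, so `S` is diagonal of trace `1` and `x` is in the hull
(`isSimplicialFace_cutHull`). The columns are independent samples. Each nonzero polynomial survives
a sample with chance at least `p²(1-p)²` (`le_sum_quadEval_ne_zero`), so the space of common zeros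
loses dimension at that rate. An exponential moment of its dimension bounds the failure probability
(`sum_common_zero_le`). -/

/-- A full double sum of a symmetric array, split into diagonal and strictly upper part. -/
theorem sum_sum_eq_diag_add_two_mul_upper {r : ℕ} (f : Fin r → Fin r → ℝ)
    (hf : ∀ a b, f a b = f b a) :
    ∑ a, ∑ b, f a b =
      ∑ a, f a a + 2 * ∑ e : {e : Fin r × Fin r // e.1 < e.2}, f e.1.1 e.1.2 := by
  have upper : ∑ e : {e : Fin r × Fin r // e.1 < e.2}, f e.1.1 e.1.2 =
      ∑ a, ∑ b, if a < b then f a b else 0 := by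
    rw [← Fintype.sum_prod_type' (f := fun a b => if a < b then f a b else 0),
      ← Finset.sum_filter]
    exact (Finset.sum_subtype _ (by simp) (fun e : Fin r × Fin r => f e.1 e.2)).symm
  have lower : ∑ a, ∑ b, (if b < a then f a b else 0) =
      ∑ a, ∑ b, if a < b then f a b else 0 := by
    rw [Finset.sum_comm]
    simp only [hf]
  have split : ∀ a b, f a b =
      (if a < b then f a b else 0) + (if a = b then f a a else 0) +
        (if b < a then f a b else 0) := by
    intro a b
    rcases lt_trichotomy a b with h | h | h
    · simp [h, h.ne, h.not_gt]
    · simp [h]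
    · simp [h, h.ne', h.not_gt]
  calc ∑ a, ∑ b, f a b = ∑ a, ∑ b, ((if a < b then f a b else 0) +
        (if a = b then f a a else 0) + (if b < a then f a b else 0)) :=
        Finset.sum_congr rfl fun a _ => Finset.sum_congr rfl fun b _ => split a b
    _ = _ := by
        simp only [Finset.sum_add_distrib, lower, upper]
        simp only [Finset.sum_ite_eq, Finset.mem_univ, if_true]
        ring

/-- Coefficients of multilinear polynomials in `r` variables spanned by the constant `1` and the
products of two distinct variables. -/
abbrev QuadCoeff (r : ℕ) : Type := ℝ × ({e : Fin r × Fin r // e.1 < e.2} → ℝ)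

/-- Evaluation of a polynomial `s + ∑_{a < b} S_{ab} x_a x_b` at the point `x`. -/
noncomputable def quadEval {r : ℕ} (x : Fin r → ℝ) : QuadCoeff r →ₗ[ℝ] ℝ where
  toFun q := q.1 + ∑ e, q.2 e * (x e.1.1 * x e.1.2)
  map_add' q q' := by
    simp only [Prod.fst_add, Prod.snd_add, Pi.add_apply, add_mul, Finset.sum_add_distrib]
    ring
  map_smul' t q := by
    simp only [Prod.smul_fst, Prod.smul_snd, Pi.smul_apply, smul_eq_mul, RingHom.id_apply, mul_add,
      Finset.mul_sum, mul_assoc]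

theorem quadEval_apply {r : ℕ} (x : Fin r → ℝ) (q : QuadCoeff r) :
    quadEval x q = q.1 + ∑ e, q.2 e * (x e.1.1 * x e.1.2) := rfl

/-! ### Deterministic criterion for a simplicial face. -/

section Deterministic

variable {n r : ℕ} {c : Fin r → Fin n → ℝ}

/-- If no nonzero polynomial `s + ∑_{a < b} S_{ab} x_a x_b` vanishes on all the columns of a sign
matrix, then a quadratic form constant on the columns is diagonal, its trace being that constant. -/
theorem offDiag_eq_zero_and_trace_eq (hc : ∀ i k, c i k * c i k = 1)
    (hq : ∀ q : QuadCoeff r, (∀ k, quadEval (fun i => c i k) q = 0) → q = 0)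
    (T : Matrix (Fin r) (Fin r) ℝ) (hT : ∀ a b, T a b = T b a) (t : ℝ)
    (h : ∀ k, ∑ a, ∑ b, T a b * (c a k * c b k) = t) :
    (∀ a b, a ≠ b → T a b = 0) ∧ ∑ a, T a a = t := by
  have key := hq (∑ a, T a a - t, fun e => 2 * T e.1.1 e.1.2) fun k => by
    have := h k
    rw [sum_sum_eq_diag_add_two_mul_upper _ fun a b => by rw [hT a b, mul_comm (c a k)]] at this
    simp only [hc, mul_one] at this
    simp only [quadEval_apply, mul_assoc, ← Finset.mul_sum]
    linarith
  have h1 : ∑ a, T a a - t = 0 := congrArg Prod.fst key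
  have h2 : ∀ e : {e : Fin r × Fin r // e.1 < e.2}, 2 * T e.1.1 e.1.2 = 0 :=
    fun e => congrFun (congrArg Prod.snd key) e
  have h3 : ∀ a b, a < b → T a b = 0 := fun a b hab => by
    have := h2 ⟨(a, b), hab⟩
    simpa using this
  refine ⟨fun a b hab => ?_, by linarith⟩
  rcases lt_or_gt_of_ne hab with h | h
  · exact h3 a b h
  · rw [hT, h3 b a h]

/-- Under the same hypothesis, the matrix whose columns are the sign vectors is left invertible. -/
theorem exists_leftInverse_of_quadEval (hc : ∀ i k, c i k * c i k = 1)
    (hq : ∀ q : QuadCoeff r, (∀ k, quadEval (fun i => c i k) q = 0) → q = 0) :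
    ∃ L : Matrix (Fin r) (Fin n) ℝ, L * (Matrix.of c).transpose = 1 := by
  have hker : LinearMap.ker (Matrix.toLin' (Matrix.of c).transpose) = ⊥ := by
    rw [LinearMap.ker_eq_bot']
    intro α hα
    have hα' : ∀ k, ∑ i, c i k * α i = 0 := fun k => congrFun hα k
    funext j
    -- This is the form `2 (α·x) x_j`, which vanishes at every column and has trace `2 α_j`.
    have := (offDiag_eq_zero_and_trace_eq hc hq
      (fun a b => α a * (if b = j then 1 else 0) + α b * (if a = j then 1 else 0))
      (fun a b => by ring) 0 fun k => by
        have e1 : ∑ a, ∑ b, α a * (if b = j then 1 else 0) * (c a k * c b k) = 0 := by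
          simp only [mul_ite, mul_one, mul_zero, ite_mul, zero_mul, Finset.sum_ite_eq',
            Finset.mem_univ, if_true]
          calc ∑ a, α a * (c a k * c j k) = (∑ a, c a k * α a) * c j k := by
                rw [Finset.sum_mul]; exact Finset.sum_congr rfl fun a _ => by ring
            _ = 0 := by rw [hα', zero_mul]
        have e2 : ∑ a, ∑ b, α b * (if a = j then 1 else 0) * (c a k * c b k) = 0 := by
          rw [Finset.sum_comm]
          refine Eq.trans (Finset.sum_congr rfl fun a _ => Finset.sum_congr rfl fun b _ => ?_) e1
          ring
        simp only [add_mul, Finset.sum_add_distrib, e1, e2, add_zero]).2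
    simp [Finset.sum_add_distrib] at this
    simpa using this
  obtain ⟨g, hg⟩ := LinearMap.exists_leftInverse_of_injective _ hker
  refine ⟨LinearMap.toMatrix' g, ?_⟩
  have := congrArg LinearMap.toMatrix' hg
  rwa [LinearMap.toMatrix'_comp, LinearMap.toMatrix'_toLin', LinearMap.toMatrix'_id] at this

theorem cutMatrix_mem_elliptope {v : Fin n → ℝ} (hv : ∀ k, v k * v k = 1) :
    cutMatrix v ∈ elliptope n :=
  ⟨by simpa [cutMatrix] using Matrix.posSemidef_vecMulVec_self_star v, hv⟩

theorem convex_elliptope (n : ℕ) : Convex ℝ (elliptope n) := by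
  rintro X ⟨hX, hX1⟩ Y ⟨hY, hY1⟩ a b ha hb hab
  exact ⟨(hX.smul ha).add (hY.smul hb), fun i => by simp [hX1, hY1, hab]⟩

theorem transpose_mul_diagonal_mul (c : Fin r → Fin n → ℝ) (d : Fin r → ℝ) :
    (Matrix.of c).transpose * Matrix.diagonal d * Matrix.of c = ∑ i, d i • cutMatrix (c i) := by
  ext k l
  rw [Matrix.mul_apply, Matrix.sum_apply]
  refine Finset.sum_congr rfl fun i _ => ?_
  rw [Matrix.mul_diagonal]
  simp [cutMatrix, Matrix.vecMulVec_apply]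
  ring

/-- A vanishing combination is `Cᵗ diag(d) C = 0`; multiplying by `L` and `Lᵗ` recovers `diag(d) =
0`. -/
theorem affineIndependent_cutMatrix {L : Matrix (Fin r) (Fin n) ℝ}
    (hL : L * (Matrix.of c).transpose = 1) :
    AffineIndependent ℝ fun i => cutMatrix (c i) := by
  refine LinearIndependent.affineIndependent ℝ (Fintype.linearIndependent_iff.2 fun d hd => ?_)
  rw [← transpose_mul_diagonal_mul] at hd
  have hL' : Matrix.of c * L.transpose = 1 := by
    simpa using congrArg Matrix.transpose hL
  have : Matrix.diagonal d = 0 := by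
    calc Matrix.diagonal d = (L * (Matrix.of c).transpose) * Matrix.diagonal d *
          (Matrix.of c * L.transpose) := by rw [hL, hL', one_mul, mul_one]
      _ = L * ((Matrix.of c).transpose * Matrix.diagonal d * Matrix.of c) * L.transpose := by
          simp only [Matrix.mul_assoc]
      _ = 0 := by rw [hd]; simp
  intro i
  simpa using congrFun (congrFun this i) i

open Matrix in
theorem isFace_cutHull (hc : ∀ i k, c i k * c i k = 1)
    (hq : ∀ q : QuadCoeff r, (∀ k, quadEval (fun i => c i k) q = 0) → q = 0) :
    IsFace (elliptope n) (cutHull c) := by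
  refine ⟨convex_convexHull ℝ _, ⟨convexHull_min ?_ (convex_elliptope n), ?_⟩⟩
  · rintro _ ⟨i, rfl⟩
    exact cutMatrix_mem_elliptope (hc i)
  rintro x ⟨hx, hx1⟩ y ⟨hy, -⟩ z hz ⟨a, b, ha, hb, -, hab⟩
  obtain ⟨L, hL⟩ := exists_leftInverse_of_quadEval hc hq
  have hL' : Matrix.of c * Lᵀ = 1 := by simpa using congrArg Matrix.transpose hL
  -- With `z = a x + b y`, both nonnegative forms must vanish where that of `z` does.
  have hker : ∀ v : Fin n → ℝ, Matrix.of c *ᵥ v = 0 → x *ᵥ v = 0 := by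
    intro v hv
    have hzv : v ⬝ᵥ z *ᵥ v = 0 := by
      have hsub : cutHull c ⊆ {w : Matrix (Fin n) (Fin n) ℝ | v ⬝ᵥ w *ᵥ v = 0} := by
        refine convexHull_min ?_ ?_
        · rintro _ ⟨i, rfl⟩
          have : c i ⬝ᵥ v = 0 := congrFun hv i
          simp [cutMatrix, Matrix.vecMulVec_mulVec, this]
        · intro w hw w' hw' a b _ _ _
          change v ⬝ᵥ w *ᵥ v = 0 at hw
          change v ⬝ᵥ w' *ᵥ v = 0 at hw'
          change v ⬝ᵥ (a • w + b • w') *ᵥ v = 0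
          rw [Matrix.add_mulVec, dotProduct_add, Matrix.smul_mulVec, Matrix.smul_mulVec,
            dotProduct_smul, dotProduct_smul, hw, hw']
          simp
      exact hsub hz
    have h1 : 0 ≤ v ⬝ᵥ x *ᵥ v := hx.dotProduct_mulVec_nonneg v
    have h2 : 0 ≤ v ⬝ᵥ y *ᵥ v := hy.dotProduct_mulVec_nonneg v
    rw [← hab, Matrix.add_mulVec, dotProduct_add, Matrix.smul_mulVec, Matrix.smul_mulVec,
      dotProduct_smul, dotProduct_smul, smul_eq_mul, smul_eq_mul] at hzv
    refine (hx.dotProduct_mulVec_zero_iff v).1 ?_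
    change v ⬝ᵥ x *ᵥ v = 0
    nlinarith [mul_nonneg hb.le h2, mul_nonneg ha.le h1]
  -- The columns of `1 - Lᵗ C` lie in `ker C`, hence in `ker x`. With the symmetry of `x` this
  -- yields `x = Cᵗ (L x Lᵗ) C`.
  have hxQ : x * (1 - Lᵀ * Matrix.of c) = 0 := by
    have hcQ : Matrix.of c * (1 - Lᵀ * Matrix.of c) = 0 := by
      rw [Matrix.mul_sub, Matrix.mul_one, ← Matrix.mul_assoc, hL', Matrix.one_mul, sub_self]
    ext k l
    have := hker (fun m => (1 - Lᵀ * Matrix.of c : Matrix (Fin n) (Fin n) ℝ) m l) (by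
      funext i
      exact congrFun (congrFun hcQ i) l)
    exact congrFun this k
  have hx2 : x = x * (Lᵀ * Matrix.of c) := by
    rw [mul_sub, mul_one, sub_eq_zero] at hxQ
    exact hxQ
  have hxt : xᵀ = x := hx.1
  have hx3 : x = (Matrix.of c)ᵀ * L * x := by
    have := congrArg Matrix.transpose hx2
    simpa [Matrix.transpose_mul, hxt] using this
  set S := L * x * Lᵀ with hS
  have hSpos : S.PosSemidef := by simpa using hx.mul_mul_conjTranspose_same L
  have hxS : x = (Matrix.of c)ᵀ * S * Matrix.of c := by
    calc x = (Matrix.of c)ᵀ * L * x := hx3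
      _ = (Matrix.of c)ᵀ * L * (x * (Lᵀ * Matrix.of c)) := by rw [← hx2]
      _ = _ := by simp only [hS, Matrix.mul_assoc]
  have hSsymm : ∀ a b, S a b = S b a := fun a b => by simpa using hSpos.1.apply b a
  obtain ⟨hoff, htr⟩ := offDiag_eq_zero_and_trace_eq hc hq S hSsymm 1 fun k => by
    rw [← hx1 k, hxS, Matrix.mul_apply, Finset.sum_comm]
    refine Finset.sum_congr rfl fun b _ => ?_
    rw [Matrix.mul_apply, Finset.sum_mul]
    refine Finset.sum_congr rfl fun a _ => ?_
    simp only [Matrix.transpose_apply, Matrix.of_apply]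
    ring
  have hSdiag : S = Matrix.diagonal fun a => S a a := by
    ext a b
    by_cases h : a = b
    · simp [h]
    · rw [hoff a b h, Matrix.diagonal_apply_ne _ h]
  rw [hxS, hSdiag, transpose_mul_diagonal_mul]
  refine (convex_convexHull ℝ _).sum_mem (fun i _ => ?_) htr fun i _ =>
    subset_convexHull ℝ _ ⟨i, rfl⟩
  exact hSpos.diag_nonneg

/-- If no nonzero polynomial `s + ∑_{a < b} S_{ab} x_a x_b` vanishes on all the columns of a sign
matrix, then its rows span a simplicial face of the elliptope. -/
theorem isSimplicialFace_cutHull (hr : 1 ≤ r) (hc : ∀ i k, c i k * c i k = 1)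
    (hq : ∀ q : QuadCoeff r, (∀ k, quadEval (fun i => c i k) q = 0) → q = 0) :
    IsSimplicialFace (elliptope n) (cutHull c) ∧ convexDim (cutHull c) = r - 1 := by
  obtain ⟨L, hL⟩ := exists_leftInverse_of_quadEval hc hq
  have hind := affineIndependent_cutMatrix hL
  have hdim : convexDim (cutHull c) = r - 1 := by
    rw [convexDim, cutHull, affineSpan_convexHull, direction_affineSpan]
    exact hind.finrank_vectorSpan (by rw [Fintype.card_fin]; omega)
  refine ⟨⟨isFace_cutHull hc hq, ?_⟩, hdim⟩
  -- Truncated subtraction: `1 ≤ r` is needed here.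
  have hr' : convexDim (cutHull c) + 1 = r := by omega
  refine ⟨fun i => cutMatrix (c (finCongr hr' i)),
    hind.comp_embedding (finCongr hr').toEmbedding, ?_⟩
  refine congrArg (convexHull ℝ) ?_
  exact ((finCongr hr').surjective.range_comp fun i => cutMatrix (c i)).symm

end Deterministic

/-! ### Common zeros of independent random functionals. -/

section Span

variable {E A : Type*} [AddCommGroup E] [Module ℝ E] [FiniteDimensional ℝ E] [Fintype A]

theorem one_sub_mul_one_sub_exp_le {δ : ℝ} (hδ : 0 ≤ δ) :
    1 - δ * (1 - Real.exp (-1 / 2)) ≤ Real.exp (-δ / 4) := by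
  have h : Real.exp (-1 / 2) ≤ 3 / 4 := by
    have h1 := Real.add_one_le_exp (1 / 2 : ℝ)
    rw [show (-1 / 2 : ℝ) = -(1 / 2) by norm_num, Real.exp_neg]
    exact inv_le_of_inv_le₀ (by norm_num) (by norm_num at h1 ⊢; linarith)
  have := Real.add_one_le_exp (-δ / 4)
  nlinarith

open Classical in
/-- Let `φ a` be random linear functionals, none of the nonzero vectors `q` being annihilated with
probability more than `1 - δ`. Then `n` independent copies have a common nonzero zero in a subspace
`V` with probability at most `exp ((dim V - 1) / 2 - δ n / 4)`. -/
theorem sum_common_zero_le (W : A → ℝ) (hW : ∀ a, 0 ≤ W a) (hW1 : ∑ a, W a = 1)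
    (φ : A → E →ₗ[ℝ] ℝ) {δ : ℝ} (hδ : 0 ≤ δ)
    (hφ : ∀ q, q ≠ 0 → δ ≤ ∑ a, if φ a q ≠ 0 then W a else 0) (n : ℕ) (V : Submodule ℝ E) :
    (∑ f : Fin n → A, if ∃ q ∈ V, q ≠ 0 ∧ ∀ k, φ (f k) q = 0 then ∏ k, W (f k) else 0) ≤
      Real.exp (((Module.finrank ℝ V : ℝ) - 1) / 2) * Real.exp (-δ / 4) ^ n := by
  induction n generalizing V with
  | zero =>
    simp only [Finset.univ_unique, IsEmpty.forall_iff, and_true, Finset.univ_eq_empty,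
      Finset.prod_empty, Finset.sum_singleton, pow_zero, mul_one]
    split_ifs with h
    · obtain ⟨q, hqV, hq⟩ := h
      have : V ≠ ⊥ := fun hV => hq ((Submodule.mem_bot ℝ).1 (hV ▸ hqV))
      have h1 : 1 ≤ Module.finrank ℝ V := Submodule.one_le_finrank_iff.2 this
      have h2 : (1 : ℝ) ≤ Module.finrank ℝ V := by exact_mod_cast h1
      exact Real.one_le_exp (by linarith)
    · positivity
  | succ n ih =>
    -- The zero space makes the event empty; otherwise the dimension is at least `1`, which explains
    -- the `-1` in the exponent.
    by_cases hV : V = ⊥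
    · refine le_trans (le_of_eq (Finset.sum_eq_zero fun f _ => if_neg ?_)) (by positivity)
      rintro ⟨q, hqV, hq, -⟩
      exact hq ((Submodule.mem_bot ℝ).1 (hV ▸ hqV))
    obtain ⟨q, hqV, hq⟩ := Submodule.exists_mem_ne_zero_of_ne_bot hV
    set M := Real.exp (((Module.finrank ℝ V : ℝ) - 1) / 2) with hM
    -- The first sample replaces `V` by `V ⊓ ker (φ a)`. If it does not kill the fixed `q`, the
    -- dimension drops and the bound gains `exp (-1/2)`.
    have step : ∀ a,
        Real.exp (((Module.finrank ℝ (V ⊓ LinearMap.ker (φ a) : Submodule ℝ E) : ℝ) - 1) / 2) ≤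
        M * (1 - if φ a q ≠ 0 then 1 - Real.exp (-1 / 2) else 0) := by
      intro a
      split_ifs with h
      · have hlt : V ⊓ LinearMap.ker (φ a) < V := by
          refine lt_of_le_of_ne inf_le_left fun heq => h ?_
          exact LinearMap.mem_ker.1 (heq.ge hqV).2
        have h1 := Submodule.finrank_lt_finrank_of_lt hlt
        have h2 : (Module.finrank ℝ (V ⊓ LinearMap.ker (φ a) : Submodule ℝ E) : ℝ) + 1 ≤
            Module.finrank ℝ V := by exact_mod_cast h1
        rw [sub_sub_cancel, hM, ← Real.exp_add]
        exact Real.exp_le_exp.2 (by linarith)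
      · have h1 : Module.finrank ℝ (V ⊓ LinearMap.ker (φ a) : Submodule ℝ E) ≤
            Module.finrank ℝ V := Submodule.finrank_mono inf_le_left
        have h2 : (Module.finrank ℝ (V ⊓ LinearMap.ker (φ a) : Submodule ℝ E) : ℝ) ≤
            Module.finrank ℝ V := by exact_mod_cast h1
        rw [sub_zero, mul_one, hM]
        exact Real.exp_le_exp.2 (by linarith)
    have hcons : ∀ (a : A) (g : Fin n → A),
        (∃ q ∈ V, q ≠ 0 ∧ ∀ k, φ (Fin.cons (α := fun _ => A) a g k) q = 0) ↔
          ∃ q ∈ V ⊓ LinearMap.ker (φ a), q ≠ 0 ∧ ∀ k, φ (g k) q = 0 := by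
      intro a g
      simp only [Fin.forall_fin_succ, Fin.cons_zero, Fin.cons_succ, Submodule.mem_inf,
        LinearMap.mem_ker]
      exact exists_congr fun q => by tauto
    rw [← (Fin.consEquiv fun _ => A).sum_comp, Fintype.sum_prod_type]
    simp only [Fin.consEquiv_apply, hcons, Fin.prod_univ_succ, Fin.cons_zero, Fin.cons_succ]
    have hR : 0 ≤ Real.exp (-δ / 4) ^ n := by positivity
    calc _ = ∑ a, W a * ∑ g : Fin n → A,
          (if ∃ q ∈ V ⊓ LinearMap.ker (φ a), q ≠ 0 ∧ ∀ k, φ (g k) q = 0 then ∏ k, W (g k)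
            else 0) := by
          simp only [Finset.mul_sum, mul_ite, mul_zero]
      _ ≤ ∑ a, W a * (M * (1 - if φ a q ≠ 0 then 1 - Real.exp (-1 / 2) else 0) *
            Real.exp (-δ / 4) ^ n) :=
          Finset.sum_le_sum fun a _ => mul_le_mul_of_nonneg_left
            ((ih _).trans (mul_le_mul_of_nonneg_right (step a) hR)) (hW a)
      _ = M * Real.exp (-δ / 4) ^ n *
            (∑ a, W a - (∑ a, if φ a q ≠ 0 then W a else 0) * (1 - Real.exp (-1 / 2))) := by
          rw [Finset.sum_mul, ← Finset.sum_sub_distrib, Finset.mul_sum]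
          refine Finset.sum_congr rfl fun a _ => ?_
          split_ifs <;> ring
      _ ≤ M * Real.exp (-δ / 4) ^ n * Real.exp (-δ / 4) := by
          refine mul_le_mul_of_nonneg_left ?_ (by positivity)
          have h1 : Real.exp (-1 / 2) ≤ 1 := Real.exp_le_one_iff.2 (by norm_num)
          have h2 := mul_le_mul_of_nonneg_right (hφ q hq) (sub_nonneg.2 h1)
          have h3 := one_sub_mul_one_sub_exp_le hδ
          rw [hW1]
          linarith
      _ = _ := by rw [pow_succ, mul_assoc]

end Span

/-! ### Quadratic polynomials on the biased cube. -/

section Cube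

/-- The sign coded by a Boolean. -/
def boolSign (b : Bool) : ℝ := if b then 1 else -1

/-- The weight of a sign under the signed Bernoulli law. -/
def boolWeight (p : ℝ) (b : Bool) : ℝ := if b then p else 1 - p

theorem sum_boolWeight (p : ℝ) : ∑ b, boolWeight p b = 1 := by simp [boolWeight]

theorem boolWeight_nonneg {p : ℝ} (h0 : 0 ≤ p) (h1 : p ≤ 1) (b : Bool) : 0 ≤ boolWeight p b := by
  cases b <;> simp [boolWeight] <;> linarith

theorem mul_one_sub_le_boolWeight {p : ℝ} (h0 : 0 ≤ p) (h1 : p ≤ 1) (b : Bool) :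
    p * (1 - p) ≤ boolWeight p b := by
  cases b <;> simp [boolWeight] <;> nlinarith

theorem sum_prod_weight {ι B : Type*} [Fintype ι] [DecidableEq ι] [Fintype B] {w : B → ℝ}
    (hw : ∑ b, w b = 1) : ∑ x : ι → B, ∏ i, w (x i) = 1 := by
  rw [← Fintype.prod_sum]
  simp [hw]

/-- Resampling one coordinate does not change an expectation under a product law. -/
theorem sum_prod_weight_update {ι B : Type*} [Fintype ι] [DecidableEq ι] [Fintype B] {w : B → ℝ}
    (hw : ∑ b, w b = 1) (g : (ι → B) → ℝ) (a : ι) :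
    ∑ x : ι → B, (∏ i, w (x i)) * g x =
      ∑ x : ι → B, (∏ i, w (x i)) * ∑ u, w u * g (Function.update x a u) := by
  have hprod : ∀ (x : ι → B) (u : B),
      (∏ i, w (x i)) * w u = (∏ i, w (Function.update x a u i)) * w (x a) := by
    intro x u
    rw [← Finset.mul_prod_erase _ _ (Finset.mem_univ a),
      ← Finset.mul_prod_erase _ (fun i => w (Function.update x a u i)) (Finset.mem_univ a),
      Function.update_self, Finset.prod_congr (g := fun i => w (Function.update x a u i)) rfl
        fun i hi => by rw [Function.update_of_ne (Finset.ne_of_mem_erase hi)]]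
    ring
  -- Exchanging coordinate `a` with a fresh independent copy preserves the product weight.
  let swap : (ι → B) × B → (ι → B) × B := fun z => (Function.update z.1 a z.2, z.1 a)
  have hswap : Function.Involutive swap := fun z => by simp [swap]
  calc ∑ x : ι → B, (∏ i, w (x i)) * g x
      = ∑ z : (ι → B) × B, (∏ i, w (z.1 i)) * w z.2 * g z.1 := by
        rw [Fintype.sum_prod_type]
        refine Finset.sum_congr rfl fun x _ => ?_
        change _ = ∑ u, (∏ i, w (x i)) * w u * g x
        rw [← Finset.sum_mul, ← Finset.mul_sum, hw, mul_one]
    _ = ∑ z : (ι → B) × B, (∏ i, w (z.1 i)) * w z.2 * g (Function.update z.1 a z.2) := by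
        rw [← Equiv.sum_comp hswap.toPerm]
        refine Finset.sum_congr rfl fun z _ => ?_
        change (∏ i, w (Function.update z.1 a z.2 i)) * w (z.1 a) * _ = _
        rw [← hprod]
        rfl
    _ = _ := by
        rw [Fintype.sum_prod_type]
        simp only [Finset.mul_sum, mul_assoc]

/-- A coefficient is a mixed second difference. -/
theorem sum_sign_quadEval_update {r : ℕ} (q : QuadCoeff r)
    (e : {e : Fin r × Fin r // e.1 < e.2}) (x : Fin r → Bool) :
    ∑ u, ∑ v, boolSign u * boolSign v * quadEval (fun i => boolSign
      (Function.update (Function.update x e.1.1 u) e.1.2 v i)) q = 4 * q.2 e := by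
  -- A monomial other than `e` misses one of the two resampled signs, whose sum cancels.
  have hmono : ∀ d : {d : Fin r × Fin r // d.1 < d.2}, ∑ u, ∑ v, boolSign u * boolSign v *
      (boolSign (Function.update (Function.update x e.1.1 u) e.1.2 v d.1.1) *
        boolSign (Function.update (Function.update x e.1.1 u) e.1.2 v d.1.2)) =
      if d = e then 4 else 0 := by
    obtain ⟨⟨a, b⟩, hab⟩ := e
    rintro ⟨⟨c, d⟩, hcd⟩
    simp only at hab hcd
    have hba := hab.ne'
    simp only [Function.update_apply, Subtype.mk.injEq, Prod.mk.injEq]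
    by_cases h1 : c = a <;> by_cases h2 : c = b <;> by_cases h3 : d = a <;> by_cases h4 : d = b <;>
      first
      | (exfalso; omega)
      | (simp [h1, h2, h3, h4, boolSign, hab.ne, hba]; try norm_num)
  calc _ = (∑ u, ∑ v, boolSign u * boolSign v * q.1) + ∑ d, q.2 d *
        ∑ u, ∑ v, boolSign u * boolSign v *
        (boolSign (Function.update (Function.update x e.1.1 u) e.1.2 v d.1.1) *
        boolSign (Function.update (Function.update x e.1.1 u) e.1.2 v d.1.2)) := by
        simp only [quadEval_apply, Fintype.sum_bool, mul_add, Finset.mul_sum,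
          Finset.sum_add_distrib]
        simp only [mul_left_comm (q.2 _)]
    _ = 4 * q.2 e := by
        simp only [hmono]
        simp [boolSign, mul_comm]

/-- A nonzero polynomial `s + ∑_{a < b} S_{ab} x_a x_b` is nonzero at a random sign vector with
probability at least `p ^ 2 * (1 - p) ^ 2`. -/
theorem le_sum_quadEval_ne_zero {r : ℕ} {p : ℝ} (h0 : 0 ≤ p) (h1 : p ≤ 1) (q : QuadCoeff r)
    (hq : q ≠ 0) :
    p ^ 2 * (1 - p) ^ 2 ≤ ∑ x : Fin r → Bool,
      if quadEval (fun i => boolSign (x i)) q ≠ 0 then ∏ i, boolWeight p (x i) else 0 := by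
  have hm : p * (1 - p) ≤ 1 := by nlinarith
  have hm0 : 0 ≤ p * (1 - p) := mul_nonneg h0 (by linarith)
  have hw := boolWeight_nonneg h0 h1
  have hsum := sum_prod_weight (ι := Fin r) (sum_boolWeight p)
  by_cases hS : q.2 = 0
  · have hs : q.1 ≠ 0 := fun h => hq (Prod.ext h hS)
    have : ∀ x : Fin r → Bool, quadEval (fun i => boolSign (x i)) q ≠ 0 := fun x => by
      simpa [quadEval_apply, hS] using hs
    simp only [this, ne_eq, not_false_eq_true, if_true, hsum]
    nlinarith
  obtain ⟨e, he⟩ := Function.ne_iff.1 hS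
  set g : (Fin r → Bool) → ℝ := fun x =>
    if quadEval (fun i => boolSign (x i)) q ≠ 0 then 1 else 0 with hg
  have hg0 : ∀ x, 0 ≤ g x := fun x => by simp only [hg]; split_ifs <;> norm_num
  -- With the other coordinates frozen, one of the four sign choices gives a nonzero value, and each
  -- sign has weight at least `p (1 - p)`.
  have hlocal : ∀ x, p ^ 2 * (1 - p) ^ 2 ≤ ∑ u, boolWeight p u * ∑ v, boolWeight p v *
      g (Function.update (Function.update x e.1.1 u) e.1.2 v) := by
    intro x
    have hex : ∃ u v, quadEval (fun i => boolSign
        (Function.update (Function.update x e.1.1 u) e.1.2 v i)) q ≠ 0 := by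
      by_contra! hcon
      have := sum_sign_quadEval_update q e x
      simp only [hcon, mul_zero, Finset.sum_const_zero] at this
      exact he (by simpa using this.symm)
    obtain ⟨u, v, huv⟩ := hex
    have hguv : g (Function.update (Function.update x e.1.1 u) e.1.2 v) = 1 := by
      simp only [hg]
      rw [if_pos huv]
    calc p ^ 2 * (1 - p) ^ 2 = p * (1 - p) * (p * (1 - p)) := by ring
      _ ≤ boolWeight p u * (boolWeight p v *
          g (Function.update (Function.update x e.1.1 u) e.1.2 v)) := by
          rw [hguv, mul_one]
          exact mul_le_mul (mul_one_sub_le_boolWeight h0 h1 u) (mul_one_sub_le_boolWeight h0 h1 v)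
            hm0 (hw u)
      _ ≤ boolWeight p u * ∑ v, boolWeight p v *
          g (Function.update (Function.update x e.1.1 u) e.1.2 v) :=
          mul_le_mul_of_nonneg_left (Finset.single_le_sum (f := fun v => boolWeight p v *
            g (Function.update (Function.update x e.1.1 u) e.1.2 v))
            (fun v _ => mul_nonneg (hw v) (hg0 _)) (Finset.mem_univ v)) (hw u)
      _ ≤ _ := Finset.single_le_sum (f := fun u => boolWeight p u * ∑ v, boolWeight p v *
            g (Function.update (Function.update x e.1.1 u) e.1.2 v))
            (fun u _ => mul_nonneg (hw u) (Finset.sum_nonneg fun v _ => mul_nonneg (hw v) (hg0 _)))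
            (Finset.mem_univ u)
  calc p ^ 2 * (1 - p) ^ 2
      = ∑ x : Fin r → Bool, (∏ i, boolWeight p (x i)) * (p ^ 2 * (1 - p) ^ 2) := by
        rw [← Finset.sum_mul, hsum, one_mul]
    _ ≤ ∑ x : Fin r → Bool, (∏ i, boolWeight p (x i)) *
          ∑ u, boolWeight p u * ∑ v, boolWeight p v *
            g (Function.update (Function.update x e.1.1 u) e.1.2 v) :=
        Finset.sum_le_sum fun x _ => mul_le_mul_of_nonneg_left (hlocal x)
          (Finset.prod_nonneg fun i _ => hw _)
    _ = ∑ x : Fin r → Bool, (∏ i, boolWeight p (x i)) * g x := by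
        exact ((sum_prod_weight_update (sum_boolWeight p) g e.1.2).trans
          (sum_prod_weight_update (sum_boolWeight p) _ e.1.1)).symm
    _ = _ := Finset.sum_congr rfl fun x _ => by simp only [hg, mul_ite, mul_one, mul_zero]

/-- The constant term accounts for the `1`; the pairs `a < b` and their swaps are disjoint among
`r²` pairs. -/
theorem finrank_quadCoeff_sub_one_le (r : ℕ) :
    (Module.finrank ℝ (QuadCoeff r) : ℝ) - 1 ≤ (r : ℝ) ^ 2 / 2 := by
  have h : Module.finrank ℝ (QuadCoeff r) =
      1 + Fintype.card {e : Fin r × Fin r // e.1 < e.2} := by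
    simp [Module.finrank_prod]
  have hswap : Fintype.card {e : Fin r × Fin r // e.1 < e.2} =
      Fintype.card {e : Fin r × Fin r // e.2 < e.1} :=
    Fintype.card_congr ((Equiv.prodComm _ _).subtypeEquiv fun _ => Iff.rfl)
  have hdisj : Fintype.card {e : Fin r × Fin r // e.1 < e.2} +
      Fintype.card {e : Fin r × Fin r // e.2 < e.1} ≤ r * r := by
    rw [← Fintype.card_subtype_or_disjoint]
    · exact (Fintype.card_subtype_le _).trans_eq (by simp)
    · rw [Pi.disjoint_iff]
      intro e
      rw [Prop.disjoint_iff]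
      exact not_and.2 fun h => h.asymm
  have : ((Fintype.card {e : Fin r × Fin r // e.1 < e.2} +
      Fintype.card {e : Fin r × Fin r // e.1 < e.2} : ℕ) : ℝ) ≤ ((r * r : ℕ) : ℝ) := by
    rw [← hswap] at hdisj
    exact_mod_cast hdisj
  rw [h]
  push_cast at this ⊢
  nlinarith

open Classical in
/-- The probability that some nonzero polynomial `s + ∑_{a < b} S_{ab} x_a x_b` vanishes on all the
columns of a random `r × n` sign matrix. -/
theorem sum_quadEval_common_zero_le (r n : ℕ) {p : ℝ} (h0 : 0 ≤ p) (h1 : p ≤ 1) :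
    (∑ ε : Fin r → Fin n → Bool,
      if ∃ q : QuadCoeff r, q ≠ 0 ∧ ∀ k, quadEval (fun i => boolSign (ε i k)) q = 0
        then ∏ i, ∏ k, boolWeight p (ε i k) else 0) ≤
      Real.exp (((r : ℝ) ^ 2 - p ^ 2 * (1 - p) ^ 2 * n) / 4) := by
  have key := sum_common_zero_le (fun x : Fin r → Bool => ∏ i, boolWeight p (x i))
    (fun x => Finset.prod_nonneg fun i _ => boolWeight_nonneg h0 h1 _)
    (sum_prod_weight (sum_boolWeight p)) (fun x => quadEval fun i => boolSign (x i))
    (by positivity) (le_sum_quadEval_ne_zero h0 h1) n ⊤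
  calc _ = ∑ f : Fin n → Fin r → Bool,
        if ∃ q : QuadCoeff r, q ∈ (⊤ : Submodule ℝ (QuadCoeff r)) ∧ q ≠ 0 ∧
          ∀ k, quadEval (fun i => boolSign (f k i)) q = 0
          then ∏ k, ∏ i, boolWeight p (f k i) else 0 := by
        -- Pass from `r` rows to `n` columns.
        rw [← (Equiv.piComm fun (_ : Fin n) (_ : Fin r) => Bool).sum_comp]
        refine Finset.sum_congr rfl fun f _ => ?_
        rw [Finset.prod_comm]
        simp only [Submodule.mem_top, true_and, Equiv.piComm_apply]
    _ ≤ _ := key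
    _ ≤ _ := by
        rw [finrank_top, ← Real.exp_nat_mul, ← Real.exp_add]
        refine Real.exp_le_exp.2 ?_
        have := finrank_quadCoeff_sub_one_le r
        linarith

end Cube

/-! ### From laws of random vectors to finite sums. -/

section Law

theorem sBern_singleton (p : unitInterval) (b : Bool) :
    (sBern p).real {boolSign b} = boolWeight p b := by
  rw [sBern, bernoulliMeasure_real_apply p (measurableSet_singleton _)]
  cases b <;> norm_num [boolSign, boolWeight]

instance isProbabilityMeasure_sBern (p : unitInterval) : IsProbabilityMeasure (sBern p) := by
  unfold sBern
  infer_instance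

theorem ae_sBern (p : unitInterval) : ∀ᵐ x ∂sBern p, ∃ b, x = boolSign b := by
  have hs : MeasurableSet {x : ℝ | ∃ b, x = boolSign b}ᶜ :=
    ((Set.finite_range boolSign).subset (by rintro x ⟨b, rfl⟩; exact ⟨b, rfl⟩)).measurableSet.compl
  rw [ae_iff]
  refine (bernoulliMeasure_apply_of_notMem_of_notMem p (s := {x : ℝ | ∃ b, x = boolSign b}ᶜ)
    hs ?_ ?_)
  · exact fun h => h ⟨true, by simp [boolSign]⟩
  · exact fun h => h ⟨false, by simp [boolSign]⟩

theorem sBernVec_real_singleton (p : unitInterval) {n : ℕ} (ε : Fin n → Bool) :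
    (sBernVec p n).real {fun k => boolSign (ε k)} = ∏ k, boolWeight p (ε k) := by
  rw [sBernVec, measureReal_def, Measure.pi_singleton, ENNReal.toReal_prod]
  exact Finset.prod_congr rfl fun k _ => sBern_singleton p (ε k)

theorem ae_sBernVec (p : unitInterval) (n : ℕ) :
    ∀ᵐ x ∂sBernVec p n, ∃ ε : Fin n → Bool, x = fun k => boolSign (ε k) := by
  have : ∀ᵐ x ∂sBernVec p n, ∀ k, ∃ b, x k = boolSign b :=
    ae_all_iff.2 fun k =>
      (Measure.tendsto_eval_ae_ae (μ := fun _ : Fin n => sBern p) (i := k)).eventually (ae_sBern p)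
  filter_upwards [this] with x hx
  choose ε hε using hx
  exact ⟨ε, funext hε⟩

variable {Ω : Type*} [MeasurableSpace Ω] {P : Measure Ω} {r n : ℕ}
  {p : unitInterval} {ξ : Fin r → Ω → Fin n → ℝ}

theorem ae_eq_boolSign (hξ : ∀ i, HasLaw (ξ i) (sBernVec p n) P) :
    ∀ᵐ ω ∂P, ∃ ε : Fin r → Fin n → Bool, ∀ i, ξ i ω = fun k => boolSign (ε i k) := by
  have : ∀ᵐ ω ∂P, ∀ i, ∃ ε : Fin n → Bool, ξ i ω = fun k => boolSign (ε k) :=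
    ae_all_iff.2 fun i => ae_of_ae_map (hξ i).aemeasurable ((hξ i).map_eq ▸ ae_sBernVec p n)
  filter_upwards [this] with ω hω
  choose ε hε using hω
  exact ⟨ε, hε⟩

theorem measureReal_eq_boolSign (hξ : ∀ i, HasLaw (ξ i) (sBernVec p n) P) (hind : iIndepFun ξ P)
    (ε : Fin r → Fin n → Bool) :
    P.real {ω | ∀ i, ξ i ω = fun k => boolSign (ε i k)} = ∏ i, ∏ k, boolWeight p (ε i k) := by
  have hset : {ω | ∀ i, ξ i ω = fun k => boolSign (ε i k)} =
      ⋂ i ∈ Finset.univ, ξ i ⁻¹' {fun k => boolSign (ε i k)} := by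
    ext ω
    simp
  rw [hset, measureReal_def, hind.measure_inter_preimage_eq_mul Finset.univ
    fun i _ => measurableSet_singleton _, ENNReal.toReal_prod]
  refine Finset.prod_congr rfl fun i _ => ?_
  rw [← sBernVec_real_singleton, measureReal_def, ← (hξ i).map_eq,
    Measure.map_apply_of_aemeasurable (hξ i).aemeasurable (measurableSet_singleton _)]

/-- The probability that independent random sign vectors do not span a simplicial face of the
elliptope of dimension `r - 1`. -/
theorem measureReal_not_isSimplicialFace_le [IsProbabilityMeasure P] (hr : 1 ≤ r)
    (hξ : ∀ i, HasLaw (ξ i) (sBernVec p n) P) (hind : iIndepFun ξ P) :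
    P.real {ω | IsSimplicialFace (elliptope n) (cutHull fun i => ξ i ω) ∧
        convexDim (cutHull fun i => ξ i ω) = r - 1}ᶜ ≤
      Real.exp (((r : ℝ) ^ 2 - (p : ℝ) ^ 2 * (1 - (p : ℝ)) ^ 2 * n) / 4) := by
  classical
  set bad : Finset (Fin r → Fin n → Bool) := Finset.univ.filter fun ε =>
    ∃ q : QuadCoeff r, q ≠ 0 ∧ ∀ k, quadEval (fun i => boolSign (ε i k)) q = 0 with hbad
  set N : Set Ω := {ω | ¬ ∃ ε : Fin r → Fin n → Bool, ∀ i, ξ i ω = fun k => boolSign (ε i k)}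
    with hN
  have hN0 : P.real N = 0 := by
    rw [measureReal_def, ae_iff.1 (ae_eq_boolSign hξ), ENNReal.toReal_zero]
  have hsub : {ω | IsSimplicialFace (elliptope n) (cutHull fun i => ξ i ω) ∧
      convexDim (cutHull fun i => ξ i ω) = r - 1}ᶜ ⊆
      -- Covering by a null set and finitely many atoms avoids measurability of the face event.
      N ∪ ⋃ ε ∈ bad, {ω | ∀ i, ξ i ω = fun k => boolSign (ε i k)} := by
    intro ω hω
    by_cases hωN : ω ∈ N
    · exact Or.inl hωN
    obtain ⟨ε, hε⟩ := not_not.1 hωN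
    refine Or.inr (Set.mem_biUnion (x := ε) ?_ hε)
    by_contra hgood
    refine hω ?_
    have hfun : (fun i => ξ i ω) = fun i k => boolSign (ε i k) := funext hε
    change IsSimplicialFace (elliptope n) (cutHull fun i => ξ i ω) ∧
      convexDim (cutHull fun i => ξ i ω) = r - 1
    rw [hfun]
    refine isSimplicialFace_cutHull hr (fun i k => ?_) fun q hq => ?_
    · cases ε i k <;> simp [boolSign]
    · by_contra hq0
      exact hgood (Finset.mem_coe.2 (Finset.mem_filter.2 ⟨Finset.mem_univ _, q, hq0, hq⟩))
  calc _ ≤ P.real (N ∪ ⋃ ε ∈ bad, {ω | ∀ i, ξ i ω = fun k => boolSign (ε i k)}) :=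
        measureReal_mono hsub
    _ ≤ P.real N + P.real (⋃ ε ∈ bad, {ω | ∀ i, ξ i ω = fun k => boolSign (ε i k)}) :=
        measureReal_union_le _ _
    _ ≤ 0 + ∑ ε ∈ bad, P.real {ω | ∀ i, ξ i ω = fun k => boolSign (ε i k)} :=
        add_le_add hN0.le (measureReal_biUnion_finset_le _ _)
    _ = ∑ ε ∈ bad, ∏ i, ∏ k, boolWeight p (ε i k) := by
        rw [zero_add]
        exact Finset.sum_congr rfl fun ε _ => measureReal_eq_boolSign hξ hind ε
    _ ≤ _ := by
        rw [hbad, Finset.sum_filter]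
        exact sum_quadEval_common_zero_le r n p.2.1 p.2.2

end Law

theorem theorem3 :
    ∃ c : ℝ, 0.0003 ≤ c ∧
      ∀ (p : unitInterval) (r n : ℕ), 0 < p → p < 1 → 1 ≤ r →
      ∀ {Ω : Type*} [MeasurableSpace Ω] (P : Measure Ω) [IsProbabilityMeasure P]
        (ξ : Fin r → Ω → Fin n → ℝ),
        (∀ i, HasLaw (ξ i) (sBernVec p n) P) → iIndepFun ξ P →
        1 - 4 * Real.exp (((r : ℝ) ^ 2 - c * (p : ℝ) ^ 2 * (1 - (p : ℝ)) ^ 2 * n) / 4) ≤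
          P.real {ω | IsSimplicialFace (elliptope n) (cutHull fun i => ξ i ω) ∧
            convexDim (cutHull fun i => ξ i ω) = r - 1} := by
  -- The argument gives `c = 1`, and the factor `4` is slack.
  refine ⟨1, by norm_num, fun p r n _ _ hr Ω _ P _ ξ hξ hind => ?_⟩
  have hbad := measureReal_not_isSimplicialFace_le hr hξ hind
  set S := {ω | IsSimplicialFace (elliptope n) (cutHull fun i => ξ i ω) ∧
    convexDim (cutHull fun i => ξ i ω) = r - 1}
  -- Subadditivity suffices and needs no measurability of `S`.
  have htot : 1 ≤ P.real S + P.real Sᶜ := by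
    have := measureReal_union_le (μ := P) S Sᶜ
    rwa [Set.union_compl_self, probReal_univ] at this
  have hpos := Real.exp_pos (((r : ℝ) ^ 2 - (p : ℝ) ^ 2 * (1 - (p : ℝ)) ^ 2 * n) / 4)
  rw [one_mul]
  linarith
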